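/- Let $\Lambda,\lambda,N$ be positive integers with $1\le\lambda\le\Lambda$, put $K=\binom{\Lambda}{\lambda}$, and assume $N\ge K$. Consider the multi-access coded caching problem with combinatorial topology: a server holds $N$ files of $B$ bits each, there are $\Lambda$ caches, and for every $\lambda$-subset $\mathcal U\subseteq\{1,\dots,\Lambda\}$ there is exactly one user, which can read exactly the caches in $\mathcal U$ (hence $K$ users). In the placement phase, before any request is known, each cache is filled with at most $MB$ bits; the placement is uncoded if every stored bit is a copy of a fixed bit of a fixed file. Then every user $\mathcal U$ requests a file $d_{\mathcal U}\in\{1,\dots,N\}$; knowing the demand vector $\boldsymbol d$, the server broadcasts without error a word whose length depends only on $\boldsymbol d$, and every user must recover its requested file without error, for all file contents, from the broadcast word, $\boldsymbol d$ and the contents of its $\lambda$ caches. A pair $(M,R)$ is achievable under uncoded placement if for some file size $B\ge 1$ there is such a procedure with uncoded placement that broadcasts at most $RB$ bits for every $\boldsymbol d$. Let $$R^\star_{\mathrm u}(M)=\inf\{R:(M,R)\text{ is achievable under uncoded placement}\}$$ be the optimal worst-case communication load. Then, on $0\le M\le N$, this is the infimum of a nonempty set of reals bounded below, and $R^\star_{\mathrm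 u}$ is the piecewise linear curve with corner points $$\bigl(M,R^\star_{\mathrm u}(M)\bigr)=\left(t\,\frac N\Lambda,\ \frac{\binom{\Lambda}{t+\lambda}}{\binom{\Lambda}{t}}\right),\qquad t\in\{0,1,\dots,\Lambda\},$$ where $\binom nk=0$ for $k>n$; that is, it takes these values at $M=tN/\Lambda$ and is linear between consecutive ones. -/

import Mathlib

namespace MACC

/-- A library of `N` files of `B` bits each; `W n b` is bit `b` of file `n`. -/
abbrev Library (N B : ℕ) : Type := Fin N → Fin B → Bool

/-- Combinatorial topology: there is exactly one user for every `lam`-subset of the `Λ` caches,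
and the user `U` is connected to exactly the caches in `U`. -/
abbrev User (Λ lam : ℕ) : Type := {U : Finset (Fin Λ) // U.card = lam}

/-- A demand vector: every user requests one file of the library. -/
abbrev Demand (Λ lam N : ℕ) : Type := User Λ lam → Fin N

/-- A caching-and-delivery procedure for files of `B` bits.
The placement does not depend on the demand. Once the demand is revealed, a word of
`length d` bits is broadcast, and each user recovers its file, without error and whatever the
library contents, from the broadcast word and the contents of the caches it is connected to. -/
structure Procedure (Λ lam N B : ℕ) where
  /-- number of bits stored in each cache -/
  cacheBits : ℕ
  /-- contents of each cache as a function of the library -/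
  place : Library N B → Fin Λ → (Fin cacheBits → Bool)
  /-- number of broadcast bits for each demand -/
  length : Demand Λ lam N → ℕ
  /-- broadcast word -/
  encode : (d : Demand Λ lam N) → Library N B → (Fin (length d) → Bool)
  /-- decoding map of each user -/
  decode : (d : Demand Λ lam N) → (U : User Λ lam) → (Fin (length d) → Bool) →
    ({c : Fin Λ // c ∈ U.1} → (Fin cacheBits → Bool)) → (Fin B → Bool)
  correct : ∀ (W : Library N B) (d : Demand Λ lam N) (U : User Λ lam),
    decode d U (encode d W) (fun c => place W c.1) = W (d U)

/-- The placement is uncoded: every stored bit is a copy of a fixed bit of a fixed file. -/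
def Procedure.IsUncoded {Λ lam N B : ℕ} (P : Procedure Λ lam N B) : Prop :=
  ∀ c : Fin Λ, ∃ σ : Fin P.cacheBits → Fin N × Fin B,
    ∀ (W : Library N B) (i : Fin P.cacheBits), P.place W c i = W (σ i).1 (σ i).2

/-- `(M, R)` is achievable under uncoded placement: for some file size `B ≥ 1` there is a
procedure with uncoded placement, with caches of at most `M * B` bits, that broadcasts at most
`R * B` bits for every demand. -/
def AchievableUncoded (Λ lam N : ℕ) (M R : ℝ) : Prop :=
  ∃ B : ℕ, 1 ≤ B ∧ ∃ P : Procedure Λ lam N B, P.IsUncoded ∧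
    (P.cacheBits : ℝ) ≤ M * B ∧ ∀ d : Demand Λ lam N, (P.length d : ℝ) ≤ R * B

/-- The optimal worst-case load under uncoded placement, as a function of the memory `M`. -/
noncomputable def optimalUncodedLoad (Λ lam N : ℕ) (M : ℝ) : ℝ :=
  sInf {R : ℝ | AchievableUncoded Λ lam N M R}

end MACC

namespace MACC

/-! The converse is an acyclic index coding bound averaged over cache orders and demands. Fix an
order of the caches and a demand with distinct files, which exists because `N ≥ K`. The requested
bits stored only in caches after all caches of their requester can be decoded from the broadcast
word alone, user by user, so their number is at most its length (`sum_card_usersBefore_le_length`).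
For a bit stored in exactly `s` caches, the number of users preceding these caches, averaged over
all orders, is at least `cornerLoad Λ lam s` (`cornerLoad_le_sum_card_usersBefore`). Averaging also
over cyclic shifts of the demand bounds the load below by the mean of `cornerLoad` over all `N * B`
bits (`sum_cornerLoad_le`). Since `cornerLoad` is convex and nonincreasing and the memory bounds the
mean of `s`, a supporting line finishes the bound (`load_ge_of_achievable`).

For achievability, each file is cut into pieces labelled by `t`-subsets of caches. For every `(t +
lam)`-set `S` the XOR of the pieces `S \ U` wanted by the users `U ⊆ S` is sent
(`broadcastSum_determines`). Memory sharing gives the rational points of each segment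
(`achievable_of_rat`); the others are approximated from below, so the load is a limit there and only
the infimum is claimed. -/

/-! ### Monotonicity and convexity of the corner loads -/

/-- The load at the `t`-th corner point. -/
noncomputable def cornerLoad (Λ lam t : ℕ) : ℝ :=
  (Nat.choose Λ (t + lam) : ℝ) / (Nat.choose Λ t : ℝ)

theorem cornerLoad_nonneg (Λ lam t : ℕ) : 0 ≤ cornerLoad Λ lam t := by
  unfold cornerLoad; positivity

theorem choose_succ_mul_real (n k : ℕ) :
    (Nat.choose n (k + 1) : ℝ) * (k + 1) = Nat.choose n k * ((n : ℝ) - k) := by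
  rcases le_or_gt k n with h | h
  · have := Nat.choose_succ_right_eq n k
    rw [← Nat.cast_sub h]
    exact_mod_cast this
  · simp [Nat.choose_eq_zero_of_lt h, Nat.choose_eq_zero_of_lt (h.trans (Nat.lt_succ_self k))]

theorem cornerLoad_succ_mul {Λ t : ℕ} (lam : ℕ) (ht : t < Λ) :
    cornerLoad Λ lam (t + 1) * ((t + lam + 1 : ℝ) * (Λ - t)) =
      cornerLoad Λ lam t * (((Λ : ℝ) - t - lam) * (t + 1)) := by
  have h1 := choose_succ_mul_real Λ t
  have h2 := choose_succ_mul_real Λ (t + lam)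
  have p1 : (0 : ℝ) < Nat.choose Λ t := by exact_mod_cast Nat.choose_pos ht.le
  have p2 : (0 : ℝ) < Nat.choose Λ (t + 1) := by exact_mod_cast Nat.choose_pos ht
  unfold cornerLoad
  rw [show t + 1 + lam = t + lam + 1 by ring]
  push_cast at h2
  rw [div_mul_eq_mul_div, div_mul_eq_mul_div, div_eq_div_iff p2.ne' p1.ne']
  calc _ = ((Nat.choose Λ (t + lam + 1) : ℝ) * (t + lam + 1)) *
        (Nat.choose Λ t * ((Λ : ℝ) - t)) := by ring
    _ = _ := by rw [h2, ← h1]; ring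

theorem cornerLoad_sub_succ {Λ t : ℕ} (lam : ℕ) (ht : t < Λ) :
    cornerLoad Λ lam t - cornerLoad Λ lam (t + 1) =
      cornerLoad Λ lam t * (lam * (Λ + 1)) / ((t + lam + 1 : ℝ) * (Λ - t)) := by
  have h := cornerLoad_succ_mul lam ht
  have p : (0 : ℝ) < Λ - t := by rw [sub_pos]; exact_mod_cast ht
  have q : (0 : ℝ) < t + lam + 1 := by positivity
  rw [eq_div_iff (by positivity), sub_mul, h]
  ring

theorem cornerLoad_succ_le {Λ t : ℕ} (lam : ℕ) (ht : t < Λ) :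
    cornerLoad Λ lam (t + 1) ≤ cornerLoad Λ lam t := by
  have p : (0 : ℝ) < Λ - t := by rw [sub_pos]; exact_mod_cast ht
  have := cornerLoad_nonneg Λ lam t
  rw [← sub_nonneg, cornerLoad_sub_succ lam ht]
  positivity

/-- The drop from `t + 1` to `t + 2` is the drop from `t` to `t + 1` times the explicit factor in
`key`, which is at most 1 as `lam ≥ 1`. -/
theorem cornerLoad_convex {Λ lam t : ℕ} (hlam : 1 ≤ lam) (ht : t + 2 ≤ Λ) :
    cornerLoad Λ lam (t + 1) - cornerLoad Λ lam t ≤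
      cornerLoad Λ lam (t + 2) - cornerLoad Λ lam (t + 1) := by
  have p : (2 : ℝ) ≤ Λ - t := by rw [le_sub_iff_add_le, add_comm]; exact_mod_cast ht
  have h0 := cornerLoad_sub_succ lam (show t < Λ by omega)
  have h1 := cornerLoad_sub_succ lam (show t + 1 < Λ by omega)
  have h := cornerLoad_succ_mul lam (show t < Λ by omega)
  have n0 := cornerLoad_nonneg Λ lam t
  have hl : (1 : ℝ) ≤ lam := by exact_mod_cast hlam
  rw [← neg_le_neg_iff, neg_sub, neg_sub, h0, h1]
  push_cast
  have q : (0 : ℝ) < t + lam + 1 := by positivity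
  have e1 : cornerLoad Λ lam (t + 1) = cornerLoad Λ lam t * (((Λ : ℝ) - t - lam) * (t + 1)) /
      ((t + lam + 1 : ℝ) * (Λ - t)) := by
    rw [eq_div_iff (by nlinarith), h]
  have key : ((Λ : ℝ) - t - lam) * (t + 1) / (((t : ℝ) + 1 + lam + 1) * (Λ - (t + 1))) ≤ 1 := by
    rw [div_le_one (by apply mul_pos <;> linarith)]
    nlinarith
  calc _ = cornerLoad Λ lam t * (lam * (Λ + 1)) / ((t + lam + 1 : ℝ) * (Λ - t)) *
        (((Λ : ℝ) - t - lam) * (t + 1) / (((t : ℝ) + 1 + lam + 1) * (Λ - (t + 1)))) := by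
        rw [e1]; ring
    _ ≤ _ := mul_le_of_le_one_right (div_nonneg (by positivity) (by nlinarith)) key

theorem supporting_line_of_convex {f : ℕ → ℝ} {n : ℕ}
    (hf : ∀ t, t + 2 ≤ n → f (t + 1) - f t ≤ f (t + 2) - f (t + 1)) {s : ℕ} (hs : s < n)
    {t : ℕ} (ht : t ≤ n) : f s + (f (s + 1) - f s) * ((t : ℝ) - s) ≤ f t := by
  have mono : ∀ k a, a + k + 1 ≤ n → f (a + 1) - f a ≤ f (a + k + 1) - f (a + k) := by
    intro k
    induction k with
    | zero => intro a _; simp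
    | succ k ih =>
      intro a ha
      exact (ih a (by omega)).trans (hf (a + k) (by omega))
  have up : ∀ k, s + k ≤ n → f s + (f (s + 1) - f s) * k ≤ f (s + k) := by
    intro k
    induction k with
    | zero => intro _; simp
    | succ k ih =>
      intro hk
      have h1 := ih (by omega)
      have h2 := mono k s (by omega)
      rw [← add_assoc]
      push_cast
      linarith
  have down : ∀ k a, a + k = s → f s - (f (s + 1) - f s) * k ≤ f a := by
    intro k
    induction k with
    | zero => rintro a rfl; simp
    | succ k ih =>
      intro a ha
      have h1 := ih (a + 1) (by omega)
      have h2 := mono (k + 1) a (by omega)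
      rw [ha] at h2
      push_cast
      linarith
  rcases le_total s t with h | h
  · obtain ⟨k, rfl⟩ := Nat.exists_eq_add_of_le h
    have := up k ht
    push_cast
    rwa [add_sub_cancel_left]
  · obtain ⟨k, rfl⟩ := Nat.exists_eq_add_of_le h
    have := down k t rfl
    push_cast
    linarith

/-! ### Counting -/

theorem exists_initial_split {α : Type*} [LinearOrder α] (m : ℕ) :
    ∀ S : Finset α, m ≤ S.card →
      ∃ U ⊆ S, U.card = m ∧ ∀ u ∈ U, ∀ x ∈ S \ U, u < x := by
  induction m with
  | zero => intro S _; exact ⟨∅, by simp⟩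
  | succ m ih =>
    intro S hS
    have hne : S.Nonempty := Finset.card_pos.mp (by omega)
    have hmin := S.min'_mem hne
    obtain ⟨U, hU, hc, hlt⟩ := ih (S.erase (S.min' hne)) (by rw [Finset.card_erase_of_mem hmin]; omega)
    have hn : S.min' hne ∉ U := fun h => by simpa using hU h
    refine ⟨insert (S.min' hne) U, ?_, by rw [Finset.card_insert_of_notMem hn, hc], ?_⟩
    · exact Finset.insert_subset hmin (hU.trans (Finset.erase_subset _ _))
    · intro u hu x hx
      simp only [Finset.mem_sdiff, Finset.mem_insert, not_or] at hx
      rcases Finset.mem_insert.mp hu with rfl | hu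
      · exact lt_of_le_of_ne (S.min'_le x hx.1) (Ne.symm hx.2.1)
      · exact hlt u hu x (by simp [hx])

open Classical in
/-- The users all of whose caches come before all caches in `T` in the order given by `π`. -/
noncomputable def usersBefore {Λ : ℕ} (lam : ℕ) (π : Equiv.Perm (Fin Λ)) (T : Finset (Fin Λ)) :
    Finset (User Λ lam) :=
  Finset.univ.filter fun U => ∀ u ∈ U.1, ∀ c ∈ T, π u < π c

/-- Ordered by `π`, a `(t + lam)`-set of caches splits into its first `lam` elements, a user, and
the other `t`, which serve as `T`. The set is recovered as their union. -/
theorem choose_le_sum_card_usersBefore {Λ : ℕ} (lam t : ℕ) (π : Equiv.Perm (Fin Λ)) :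
    Nat.choose Λ (t + lam) ≤
      ∑ T ∈ Finset.powersetCard t (Finset.univ : Finset (Fin Λ)), (usersBefore lam π T).card := by
  classical
  have split : ∀ S : Finset (Fin Λ), S.card = t + lam → ∃ U : User Λ lam, U.1 ⊆ S ∧
      ∀ u ∈ U.1, ∀ x ∈ S \ U.1, π u < π x := by
    intro S hS
    obtain ⟨U, hU, hc, hlt⟩ := exists_initial_split lam (S.map π.toEmbedding)
      (by rw [Finset.card_map]; omega)
    refine ⟨⟨U.map π.symm.toEmbedding, by rw [Finset.card_map, hc]⟩, ?_, ?_⟩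
    · intro x hx
      obtain ⟨y, hy, rfl⟩ := Finset.mem_map.mp hx
      obtain ⟨z, hz, rfl⟩ := Finset.mem_map.mp (hU hy)
      simpa using hz
    · intro u hu x hx
      obtain ⟨y, hy, rfl⟩ := Finset.mem_map.mp hu
      rw [Finset.mem_sdiff] at hx
      refine hlt _ (by simpa using hy) _ ?_
      simp only [Finset.mem_sdiff, Finset.mem_map_equiv, Equiv.symm_apply_apply] at hx ⊢
      exact ⟨hx.1, by simpa using hx.2⟩
  rw [← Finset.card_sigma]
  calc Nat.choose Λ (t + lam)
      = (Finset.powersetCard (t + lam) (Finset.univ : Finset (Fin Λ))).card := by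
        rw [Finset.card_powersetCard, Finset.card_univ, Fintype.card_fin]
    _ ≤ _ := by
      refine Finset.card_le_card_of_surjOn (fun p => p.1 ∪ p.2.1) ?_
      intro S hS
      have hS := (Finset.mem_powersetCard_univ.mp hS)
      obtain ⟨U, h1, h2⟩ := split S hS
      refine ⟨⟨S \ U.1, U⟩, ?_, Finset.sdiff_union_of_subset h1⟩
      simp only [Finset.coe_sigma, Set.mem_sigma_iff, Finset.mem_coe, Finset.mem_powersetCard_univ,
        usersBefore, Finset.mem_filter, Finset.mem_univ, true_and]
      refine ⟨?_, h2⟩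
      rw [Finset.card_sdiff_of_subset h1, hS, U.2]
      omega

theorem card_usersBefore_map {Λ : ℕ} (lam : ℕ) (π τ : Equiv.Perm (Fin Λ)) (T : Finset (Fin Λ)) :
    (usersBefore lam π (T.map τ.toEmbedding)).card = (usersBefore lam (τ.trans π) T).card := by
  classical
  refine (Finset.card_bij (fun U _ => ⟨U.1.map τ.toEmbedding, by rw [Finset.card_map, U.2]⟩)
    ?_ ?_ ?_).symm
  · intro U hU
    simp only [usersBefore, Finset.mem_filter, Finset.mem_univ, true_and] at hU ⊢
    simpa only [Finset.forall_mem_map, Equiv.coe_toEmbedding, Equiv.trans_apply] using hU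
  · intro U _ U' _ h
    exact Subtype.ext (Finset.map_injective _ (congrArg Subtype.val h))
  · intro V hV
    refine ⟨⟨V.1.map τ.symm.toEmbedding, by rw [Finset.card_map, V.2]⟩, ?_, ?_⟩
    · simp only [usersBefore, Finset.mem_filter, Finset.mem_univ, true_and] at hV ⊢
      simpa only [Finset.forall_mem_map, Equiv.coe_toEmbedding, Equiv.trans_apply,
        Equiv.apply_symm_apply] using hV
    · apply Subtype.ext
      ext x
      simp

/-- Summed over all `π`, the count depends only on the size of `T`, so each of the `Nat.choose Λ
T.card` sets gets an equal share of the previous bound. -/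
theorem cornerLoad_le_sum_card_usersBefore {Λ : ℕ} (lam : ℕ) (T : Finset (Fin Λ)) :
    (Λ.factorial : ℝ) * cornerLoad Λ lam T.card ≤
      ∑ π : Equiv.Perm (Fin Λ), ((usersBefore lam π T).card : ℝ) := by
  classical
  have sym : ∀ T' ∈ Finset.powersetCard T.card (Finset.univ : Finset (Fin Λ)),
      ∑ π : Equiv.Perm (Fin Λ), (usersBefore lam π T').card =
        ∑ π : Equiv.Perm (Fin Λ), (usersBefore lam π T).card := by
    intro T' hT'
    have hc : T.card = T'.card := (Finset.mem_powersetCard_univ.mp hT').symm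
    obtain ⟨τ, hτ⟩ : ∃ τ : Equiv.Perm (Fin Λ), T.map τ.toEmbedding = T' := by
      let e : {x // x ∈ T} ≃ {x // x ∈ T'} := Finset.equivOfCardEq hc
      refine ⟨e.extendSubtype, Finset.eq_of_subset_of_card_le ?_ (by rw [Finset.card_map, hc])⟩
      simp only [Finset.subset_iff, Finset.forall_mem_map]
      exact fun x hx => e.extendSubtype_mem x hx
    rw [← hτ]
    simp_rw [card_usersBefore_map]
    exact Equiv.sum_comp (Equiv.mulRight τ) (fun π => (usersBefore lam π T).card)
  have h := Finset.sum_le_sum fun π (_ : π ∈ (Finset.univ : Finset (Equiv.Perm (Fin Λ)))) =>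
    choose_le_sum_card_usersBefore lam T.card π
  rw [Finset.sum_comm, Finset.sum_congr rfl sym, Finset.sum_const, Finset.sum_const,
    Finset.card_powersetCard, Finset.card_univ, Finset.card_univ, Fintype.card_perm,
    Fintype.card_fin, smul_eq_mul, smul_eq_mul] at h
  have pos : (0 : ℝ) < Nat.choose Λ T.card := by
    exact_mod_cast Nat.choose_pos (by simpa using T.card_le_univ)
  unfold cornerLoad
  rw [← mul_div_assoc, div_le_iff₀ pos, mul_comm _ (Nat.choose Λ T.card : ℝ)]
  exact_mod_cast h

variable {Λ lam N B : ℕ}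

/-! ### Converse -/

/-- The caches that store a given bit, for the placement given by `σ`. -/
def storedIn {m : ℕ} (σ : Fin Λ → Fin m → Fin N × Fin B) (x : Fin N × Fin B) :
    Finset (Fin Λ) :=
  Finset.univ.filter fun c => ∃ i, σ c i = x

theorem sum_card_storedIn_le {m : ℕ} (σ : Fin Λ → Fin m → Fin N × Fin B) :
    ∑ x, (storedIn σ x).card ≤ Λ * m := by
  have h : ∀ c : Fin Λ, (Finset.univ.filter fun x => ∃ i, σ c i = x).card ≤ m := by
    intro c
    have : (Finset.univ.filter fun x => ∃ i, σ c i = x) = Finset.univ.image (σ c) := by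
      ext x; simp
    rw [this]
    exact Finset.card_image_le.trans (by simp)
  calc ∑ x, (storedIn σ x).card
      = ∑ c : Fin Λ, (Finset.univ.filter fun x => ∃ i, σ c i = x).card := by
        simp only [storedIn, Finset.card_filter]
        exact Finset.sum_comm
    _ ≤ ∑ _c : Fin Λ, m := Finset.sum_le_sum fun c _ => h c
    _ = Λ * m := by simp

/-- Acyclic index coding bound: for distinct demands, the bits requested by a user that are only
stored in caches after those of the user can be recovered from the broadcast word alone. -/
theorem sum_card_usersBefore_le_length (hlam : 1 ≤ lam) (P : Procedure Λ lam N B)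
    (σ : Fin Λ → Fin P.cacheBits → Fin N × Fin B)
    (hσ : ∀ c W i, P.place W c i = W (σ c i).1 (σ c i).2)
    {d : Demand Λ lam N} (hd : Function.Injective d) (π : Equiv.Perm (Fin Λ)) :
    ∑ U : User Λ lam, (Finset.univ.filter fun b : Fin B =>
      U ∈ usersBefore lam π (storedIn σ (d U, b))).card ≤ P.length d := by
  classical
  let V : Finset (Σ _ : User Λ lam, Fin B) := Finset.univ.sigma fun U =>
    Finset.univ.filter fun b : Fin B => U ∈ usersBefore lam π (storedIn σ (d U, b))
  -- The bits in `V` are free and all others are `false`; injectivity of `d` makes the chosen user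
  -- unique.
  let lib : (V → Bool) → Library N B := fun x n b =>
    if h : ∃ U, d U = n ∧ (⟨U, b⟩ : Σ _ : User Λ lam, Fin B) ∈ V then
      x ⟨⟨h.choose, b⟩, h.choose_spec.2⟩ else false
  have lib_apply : ∀ x U b (h : (⟨U, b⟩ : Σ _ : User Λ lam, Fin B) ∈ V),
      lib x (d U) b = x ⟨⟨U, b⟩, h⟩ := by
    intro x U b h
    have h' : ∃ U', d U' = d U ∧ (⟨U', b⟩ : Σ _ : User Λ lam, Fin B) ∈ V := ⟨U, rfl, h⟩
    have e : h'.choose = U := hd h'.choose_spec.1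
    simp only [lib, dif_pos h']
    congr 3
  -- The rank of the last cache of a user orders the decoding: a free bit cached by `U` is requested
  -- by a user of smaller `pos`, hence already known.
  let pos : User Λ lam → ℕ := fun U => U.1.sup fun u => (π u : ℕ)
  have inj : Function.Injective fun x => P.encode d (lib x) := by
    intro x y hxy
    have eq : ∀ p U, pos U = p → lib x (d U) = lib y (d U) := by
      intro p
      induction p using Nat.strong_induction_on with
      | _ p ih =>
        intro U hU
        have hc : (fun c : {c : Fin Λ // c ∈ U.1} => P.place (lib x) c.1) =
            fun c => P.place (lib y) c.1 := by
          funext c i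
          rw [hσ, hσ]
          by_cases h : ∃ U', d U' = (σ c.1 i).1 ∧
              (⟨U', (σ c.1 i).2⟩ : Σ _ : User Λ lam, Fin B) ∈ V
          · obtain ⟨U', h1, h2⟩ := h
            rw [← h1]
            refine congrFun (ih (pos U') ?_ U' rfl) _
            have h3 : ∀ u ∈ U'.1, π u < π c.1 := by
              intro u hu
              have := (Finset.mem_filter.mp (Finset.mem_sigma.mp h2).2).2
              refine (Finset.mem_filter.mp this).2 u hu c.1 ?_
              rw [h1]
              exact Finset.mem_filter.mpr ⟨Finset.mem_univ _, i, rfl⟩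
            have h4 : ((π c.1 : Fin Λ) : ℕ) ≤ pos U :=
              Finset.le_sup (f := fun u => ((π u : Fin Λ) : ℕ)) c.2
            -- `Finset.sup_lt_iff` needs a positive bound; this comes from `U'` being nonempty.
            obtain ⟨u, hu⟩ := Finset.card_pos.mp (show 0 < U'.1.card by rw [U'.2]; omega)
            rw [← hU]
            refine lt_of_lt_of_le ?_ h4
            refine (Finset.sup_lt_iff ?_).mpr fun u hu => h3 u hu
            exact lt_of_le_of_lt (Nat.zero_le _) (h3 u hu)
          · simp only [lib, dif_neg h]
        rw [← P.correct (lib x) d U, ← P.correct (lib y) d U, hc]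
        exact congrArg (fun w => P.decode d U w _) hxy
    funext ⟨⟨U, b⟩, h⟩
    rw [← lib_apply x U b h, ← lib_apply y U b h, eq _ U rfl]
  have hcard := Fintype.card_le_of_injective _ inj
  simp only [Fintype.card_fun, Fintype.card_bool, Fintype.card_fin, Fintype.card_coe] at hcard
  have := (Nat.pow_le_pow_iff_right (by norm_num)).mp hcard
  simpa [V] using this

theorem sum_cornerLoad_le (hlam : 1 ≤ lam) (hN : Nat.choose Λ lam ≤ N) (hN0 : 0 < N)
    (P : Procedure Λ lam N B)
    (σ : Fin Λ → Fin P.cacheBits → Fin N × Fin B)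
    (hσ : ∀ c W i, P.place W c i = W (σ c i).1 (σ c i).2) {L : ℝ}
    (hL : ∀ d, (P.length d : ℝ) ≤ L) :
    ∑ x, cornerLoad Λ lam (storedIn σ x).card ≤ N * L := by
  classical
  have : NeZero N := ⟨hN0.ne'⟩
  have hcard : Fintype.card (User Λ lam) ≤ Fintype.card (Fin N) := by
    rw [Fintype.card_finset_len, Fintype.card_fin, Fintype.card_fin]
    exact hN
  obtain ⟨d₀⟩ := Function.Embedding.nonempty_of_card_le hcard
  -- As `s` varies, the shifted demand `s + d₀ U` stays injective in `U` and makes each user request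
  -- every file exactly once.
  have hb : ∀ (s : Fin N) (π : Equiv.Perm (Fin Λ)),
      ∑ U : User Λ lam, ∑ b : Fin B,
        (if U ∈ usersBefore lam π (storedIn σ (s + d₀ U, b)) then (1 : ℝ) else 0) ≤ L := by
    intro s π
    have := sum_card_usersBefore_le_length hlam P σ hσ (d := fun U => s + d₀ U)
      (fun U U' h => d₀.injective (add_left_cancel h)) π
    refine le_trans ?_ (hL fun U => s + d₀ U)
    simp only [Finset.card_filter] at this
    exact_mod_cast this
  have hsum : ∑ s : Fin N, ∑ π : Equiv.Perm (Fin Λ), ∑ U : User Λ lam, ∑ b : Fin B,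
        (if U ∈ usersBefore lam π (storedIn σ (s + d₀ U, b)) then (1 : ℝ) else 0) =
      ∑ x, ∑ π : Equiv.Perm (Fin Λ), ((usersBefore lam π (storedIn σ x)).card : ℝ) := by
    calc _ = ∑ π : Equiv.Perm (Fin Λ), ∑ U : User Λ lam, ∑ s : Fin N, ∑ b : Fin B,
        (if U ∈ usersBefore lam π (storedIn σ (s + d₀ U, b)) then (1 : ℝ) else 0) := by
          rw [Finset.sum_comm]
          exact Finset.sum_congr rfl fun π _ => Finset.sum_comm
      _ = ∑ π : Equiv.Perm (Fin Λ), ∑ U : User Λ lam, ∑ x : Fin N × Fin B,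
        (if U ∈ usersBefore lam π (storedIn σ x) then (1 : ℝ) else 0) := by
          refine Finset.sum_congr rfl fun π _ => Finset.sum_congr rfl fun U _ => ?_
          rw [Fintype.sum_prod_type]
          exact Equiv.sum_comp (Equiv.addRight (d₀ U)) fun n => ∑ b : Fin B,
            (if U ∈ usersBefore lam π (storedIn σ (n, b)) then (1 : ℝ) else 0)
      _ = _ := by
          rw [Finset.sum_comm (s := (Finset.univ : Finset (Fin N × Fin B)))]
          refine Finset.sum_congr rfl fun π _ => ?_
          rw [Finset.sum_comm]
          refine Finset.sum_congr rfl fun x _ => ?_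
          simp
  have h1 : (Λ.factorial : ℝ) * ∑ x, cornerLoad Λ lam (storedIn σ x).card ≤
      N * (Λ.factorial * L) := by
    rw [Finset.mul_sum]
    calc _ ≤ _ := Finset.sum_le_sum fun x _ =>
          cornerLoad_le_sum_card_usersBefore lam (storedIn σ x)
      _ = _ := hsum.symm
      _ ≤ ∑ _s : Fin N, ∑ _π : Equiv.Perm (Fin Λ), L :=
          Finset.sum_le_sum fun s _ => Finset.sum_le_sum fun π _ => hb s π
      _ = _ := by simp [Fintype.card_perm]
  have hf : (0 : ℝ) < Λ.factorial := by exact_mod_cast Λ.factorial_pos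
  rw [mul_left_comm] at h1
  exact le_of_mul_le_mul_left h1 hf

/-- The load is at least the value of the curve at the point with parameter `θ` of the segment
starting at corner `t`. -/
theorem load_ge_of_achievable (hlam : 1 ≤ lam) (hN : Nat.choose Λ lam ≤ N) (hN0 : 0 < N)
    {t : ℕ} (ht : t < Λ) {θ R : ℝ}
    (h : AchievableUncoded Λ lam N ((t + θ) * (N / Λ)) R) :
    cornerLoad Λ lam t + (cornerLoad Λ lam (t + 1) - cornerLoad Λ lam t) * θ ≤ R := by
  obtain ⟨B, hB, P, hP, hM, hL⟩ := h
  choose σ hσ using hP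
  have h1 := sum_cornerLoad_le hlam hN hN0 P σ hσ hL
  have hslope := cornerLoad_succ_le lam ht
  set D := cornerLoad Λ lam (t + 1) - cornerLoad Λ lam t with hD
  have h2 : ∑ x : Fin N × Fin B, (cornerLoad Λ lam t + D * (((storedIn σ x).card : ℝ) - t)) ≤
      ∑ x, cornerLoad Λ lam (storedIn σ x).card :=
    -- Jensen's inequality, through the line extending the segment from `t` to `t + 1`.
    Finset.sum_le_sum fun x _ => supporting_line_of_convex (f := cornerLoad Λ lam)
      (fun s hs => cornerLoad_convex hlam hs) ht (by simpa using (storedIn σ x).card_le_univ)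
  rw [Finset.sum_add_distrib, ← Finset.mul_sum, Finset.sum_sub_distrib] at h2
  simp only [Finset.sum_const, Finset.card_univ, Fintype.card_prod, Fintype.card_fin,
    nsmul_eq_mul] at h2
  push_cast at h2
  have h3 : (∑ x, ((storedIn σ x).card : ℝ)) ≤ N * B * (t + θ) := by
    have hΛ : (0 : ℝ) < Λ := by exact_mod_cast (Nat.zero_le t).trans_lt ht
    have := sum_card_storedIn_le σ
    calc (∑ x, ((storedIn σ x).card : ℝ)) ≤ Λ * P.cacheBits := by exact_mod_cast this
      _ ≤ Λ * ((t + θ) * (N / Λ) * B) := by gcongr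
      _ = _ := by field_simp
  have h4 : D * (N * B * (t + θ)) ≤ D * ∑ x, ((storedIn σ x).card : ℝ) :=
    mul_le_mul_of_nonpos_left h3 (by rw [hD]; linarith)
  have hNB : (0 : ℝ) < N * B := by
    have : (0 : ℝ) < B := by exact_mod_cast hB
    have : (0 : ℝ) < N := by exact_mod_cast hN0
    positivity
  refine le_of_mul_le_mul_left ?_ hNB
  nlinarith

/-! ### Achievability -/

/-- A delivery scheme given by the set `τ b` of caches storing the bit `b` of each file and an
encoding map, such that every user can determine its file, yields a procedure. -/
theorem exists_procedure_of_determined {β δ : Type*} [Fintype β] [Fintype δ]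
    (τ : β → Finset (Fin Λ)) (enc : Demand Λ lam N → (Fin N → β → Bool) → δ → Bool) {m : ℕ}
    (hm : ∀ c, (Finset.univ.filter fun b => c ∈ τ b).card = m)
    (det : ∀ d (U : User Λ lam) W W', enc d W = enc d W' →
      (∀ n b, ∀ c ∈ U.1, c ∈ τ b → W n b = W' n b) → W (d U) = W' (d U)) :
    ∃ P : Procedure Λ lam N (Fintype.card β), P.IsUncoded ∧ P.cacheBits = N * m ∧
      ∀ d, P.length d = Fintype.card δ := by
  classical
  let eβ := Fintype.equivFin β
  let eδ := Fintype.equivFin δ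
  have hγ : ∀ c, Fintype.card (Fin N × {b // c ∈ τ b}) = N * m := by
    intro c
    rw [Fintype.card_prod, Fintype.card_fin, Fintype.card_subtype, hm]
  let eγ : ∀ c, (Fin N × {b // c ∈ τ b}) ≃ Fin (N * m) := fun c =>
    Fintype.equivFinOfCardEq (hγ c)
  let pull : Library N (Fintype.card β) → Fin N → β → Bool := fun W n b => W n (eβ b)
  let σ : Fin Λ → Fin (N * m) → Fin N × Fin (Fintype.card β) := fun c i =>
    (((eγ c).symm i).1, eβ ((eγ c).symm i).2.1)
  let place : Library N (Fintype.card β) → Fin Λ → Fin (N * m) → Bool := fun W c i =>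
    W (σ c i).1 (σ c i).2
  let code : Demand Λ lam N → Library N (Fintype.card β) → Fin (Fintype.card δ) → Bool :=
    fun d W j => enc d (pull W) (eδ.symm j)
  have key : ∀ d (U : User Λ lam) W W', code d W = code d W' →
      (fun c : {c // c ∈ U.1} => place W c.1) = (fun c => place W' c.1) → W (d U) = W' (d U) := by
    intro d U W W' h1 h2
    have h3 := det d U (pull W) (pull W') ?_ ?_
    · funext i
      simpa [pull] using congrFun h3 (eβ.symm i)
    · funext j
      simpa [code] using congrFun h1 (eδ j)
    · intro n b c hc hb
      simpa [place, σ] using congrFun (congrFun h2 ⟨c, hc⟩) (eγ c (n, ⟨b, hb⟩))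
  refine ⟨{ cacheBits := N * m
            place := place
            length := fun _ => Fintype.card δ
            encode := code
            -- Any library consistent with the observations has the right requested file, by `key`;
            -- the default `false` is never reached on genuine observations.
            decode := fun d U w z =>
              if h : ∃ W, code d W = w ∧ (fun c : {c // c ∈ U.1} => place W c.1) = z then
                h.choose (d U) else fun _ => false
            correct := ?_ }, fun c => ⟨σ c, fun W i => rfl⟩, rfl, fun _ => rfl⟩
  intro W d U
  have h : ∃ W', code d W' = code d W ∧
      (fun c : {c // c ∈ U.1} => place W' c.1) = fun c => place W c.1 := ⟨W, rfl, rfl⟩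
  rw [dif_pos h]
  exact key d U _ _ h.choose_spec.1 h.choose_spec.2

theorem mul_card_filter_mem_finset_len (t : ℕ) (c : Fin Λ) :
    Λ * (Finset.univ.filter fun T : {T : Finset (Fin Λ) // T.card = t} => c ∈ T.1).card =
      t * Nat.choose Λ t := by
  classical
  obtain ⟨n, rfl⟩ : ∃ n, Λ = n + 1 := Nat.exists_eq_add_one.mpr c.pos
  have h1 : (Finset.univ.filter fun T : {T : Finset (Fin (n + 1)) // T.card = t} =>
      c ∈ T.1).card = ((Finset.powersetCard t Finset.univ).filter (c ∈ ·)).card := by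
    refine Finset.card_bij (fun T _ => T.1) ?_ (fun _ _ _ _ h => Subtype.ext h) ?_
    · intro T hT
      simpa [T.2] using hT
    · intro T hT
      simp only [Finset.mem_filter, Finset.mem_powersetCard_univ] at hT
      exact ⟨⟨T, hT.1⟩, by simpa using hT.2, rfl⟩
  have h2 : ((Finset.powersetCard t Finset.univ).filter (c ∉ ·)) =
      Finset.powersetCard t (Finset.univ.erase c) := by
    ext T
    simp [Finset.mem_powersetCard, Finset.subset_erase, and_comm]
  have h3 := Finset.card_filter_add_card_filter_not
    (s := Finset.powersetCard t (Finset.univ : Finset (Fin (n + 1)))) (c ∈ ·)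
  rw [h2, Finset.card_powersetCard, Finset.card_powersetCard, Finset.card_erase_of_mem
    (Finset.mem_univ c), Finset.card_univ, Fintype.card_fin, Nat.add_sub_cancel] at h3
  rw [h1]
  cases t with
  | zero =>
    simp
  | succ s =>
    rw [Nat.choose_succ_succ, add_left_inj] at h3
    rw [h3, Nat.add_one_mul_choose_eq, mul_comm]

open Classical in
/-- The sum of the file pieces requested by the users contained in `S`, the piece for the user
`U` being the one labelled by `S \ U`. -/
noncomputable def broadcastSum {κ : Type*} {t : κ → ℕ} (d : Demand Λ lam N)
    (W : Fin N → (Σ k, {T : Finset (Fin Λ) // T.card = t k}) → Bool) (k : κ)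
    (S : Finset (Fin Λ)) : ZMod 2 :=
  ∑ U : User Λ lam, if h : U.1 ⊆ S ∧ (S \ U.1).card = t k then
    (if W (d U) ⟨k, ⟨S \ U.1, h.2⟩⟩ then 1 else 0) else 0

/-- A piece whose label `T` meets `U` is cached. Otherwise it occurs in the sum for `S = T ∪ U`,
where every other summand is labelled by some `S \ U'` that meets `U`, hence is known to `U` and
cancels. -/
theorem broadcastSum_determines {κ : Type*} {t : κ → ℕ} (d : Demand Λ lam N) (U : User Λ lam)
    (W W' : Fin N → (Σ k, {T : Finset (Fin Λ) // T.card = t k}) → Bool)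
    (henc : ∀ (k : κ) (S : {S : Finset (Fin Λ) // S.card = t k + lam}),
      broadcastSum d W k S.1 = broadcastSum d W' k S.1)
    (hcache : ∀ n b, ∀ c ∈ U.1, c ∈ b.2.1 → W n b = W' n b) : W (d U) = W' (d U) := by
  classical
  funext ⟨k, T, hT⟩
  by_cases hdis : Disjoint T U.1
  · have hS : (T ∪ U.1).card = t k + lam := by rw [Finset.card_union_of_disjoint hdis, hT, U.2]
    have h := henc k ⟨T ∪ U.1, hS⟩
    have hTU : (T ∪ U.1) \ U.1 = T := by
      rw [Finset.union_sdiff_right, Finset.sdiff_eq_self_of_disjoint hdis]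
    simp only [broadcastSum] at h
    rw [← Finset.add_sum_erase _ _ (Finset.mem_univ U),
      ← Finset.add_sum_erase _ _ (Finset.mem_univ U)] at h
    rw [Finset.sum_congr rfl (g := fun U' : User Λ lam =>
      if h : U'.1 ⊆ T ∪ U.1 ∧ ((T ∪ U.1) \ U'.1).card = t k then
        (if W' (d U') ⟨k, ⟨(T ∪ U.1) \ U'.1, h.2⟩⟩ then (1 : ZMod 2) else 0) else 0)] at h
    · have h' := add_right_cancel h
      have hc : U.1 ⊆ T ∪ U.1 ∧ ((T ∪ U.1) \ U.1).card = t k :=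
        ⟨Finset.subset_union_right, by rw [hTU, hT]⟩
      rw [dif_pos hc, dif_pos hc] at h'
      simp only [hTU] at h'
      cases h1 : W (d U) ⟨k, T, hT⟩ <;> cases h2 : W' (d U) ⟨k, T, hT⟩ <;> simp [h1, h2] at h' ⊢
    · intro U' hU'
      by_cases hc : U'.1 ⊆ T ∪ U.1 ∧ ((T ∪ U.1) \ U'.1).card = t k
      · have hne : U' ≠ U := (Finset.mem_erase.mp hU').1
        obtain ⟨c, hcU, hcU'⟩ : ∃ c ∈ U.1, c ∉ U'.1 := by
          by_contra! hsub
          exact hne (Subtype.ext (Finset.eq_of_subset_of_card_le hsub (by rw [U.2, U'.2])).symm)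
        rw [dif_pos hc, dif_pos hc,
          hcache _ ⟨k, ⟨(T ∪ U.1) \ U'.1, hc.2⟩⟩ c hcU (by simp [hcU, hcU'])]
      · rw [dif_neg hc, dif_neg hc]
  · obtain ⟨c, hcT, hcU⟩ := Finset.not_disjoint_iff.mp hdis
    exact hcache _ _ c hcU hcT

/-- Memory sharing: the files are cut into blocks indexed by `κ`, and block `k` uses the scheme with
parameter `t k`. -/
theorem exists_combined_procedure {Λ : ℕ} (hΛ : 0 < Λ) (lam N : ℕ) {κ : Type*} [Fintype κ]
    (t : κ → ℕ) :
    ∃ P : Procedure Λ lam N (∑ k, Nat.choose Λ (t k)), P.IsUncoded ∧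
      Λ * P.cacheBits = N * ∑ k, t k * Nat.choose Λ (t k) ∧
      ∀ d, P.length d = ∑ k, Nat.choose Λ (t k + lam) := by
  classical
  have hb : Fintype.card (Σ k, {T : Finset (Fin Λ) // T.card = t k}) =
      ∑ k, Nat.choose Λ (t k) := by
    simp [Fintype.card_sigma, Fintype.card_finset_len]
  have hd : Fintype.card (Σ k, {S : Finset (Fin Λ) // S.card = t k + lam}) =
      ∑ k, Nat.choose Λ (t k + lam) := by
    simp [Fintype.card_sigma, Fintype.card_finset_len]
  rw [← hb, ← hd]
  have count : ∀ c : Fin Λ, (Finset.univ.filter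
      fun b : Σ k, {T : Finset (Fin Λ) // T.card = t k} => c ∈ b.2.1).card =
        ∑ k, t k * Nat.choose Λ (t k) / Λ := by
    intro c
    have h : (Finset.univ.filter fun b : Σ k, {T : Finset (Fin Λ) // T.card = t k} => c ∈ b.2.1) =
        Finset.univ.sigma fun k =>
          Finset.univ.filter fun T : {T : Finset (Fin Λ) // T.card = t k} => c ∈ T.1 := by
      ext; simp
    rw [h, Finset.card_sigma]
    refine Finset.sum_congr rfl fun k _ => ?_
    rw [← mul_card_filter_mem_finset_len (t k) c, Nat.mul_div_cancel_left _ hΛ]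
  let enc : Demand Λ lam N → (Fin N → (Σ k, {T : Finset (Fin Λ) // T.card = t k}) → Bool) →
      (Σ k, {S : Finset (Fin Λ) // S.card = t k + lam}) → Bool :=
    fun d W s => decide (broadcastSum d W s.1 s.2.1 = 1)
  have det : ∀ d (U : User Λ lam) W W', enc d W = enc d W' →
      (∀ n b, ∀ c ∈ U.1, c ∈ b.2.1 → W n b = W' n b) → W (d U) = W' (d U) := by
    intro d U W W' h hc
    refine broadcastSum_determines d U W W' (fun k S => ?_) hc
    have h1 := congrFun h ⟨k, S⟩
    simp only [enc, decide_eq_decide] at h1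
    -- An element of `ZMod 2` is determined by whether it equals 1.
    revert h1
    generalize broadcastSum d W k S.1 = x
    generalize broadcastSum d W' k S.1 = y
    revert x y
    decide
  obtain ⟨P, hP, hm, hL⟩ := exists_procedure_of_determined (fun b => b.2.1) enc count det
  refine ⟨P, hP, ?_, hL⟩
  rw [hm, mul_left_comm, Finset.mul_sum]
  congr 1
  exact Finset.sum_congr rfl fun k _ => Nat.mul_div_cancel'
    ⟨_, (mul_card_filter_mem_finset_len (t k) ⟨0, hΛ⟩).symm⟩

theorem achievable_of_rat {Λ lam N t p q : ℕ} (ht : t < Λ) (hq : 0 < q) (hp : p ≤ q) :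
    AchievableUncoded Λ lam N ((t + (p / q : ℝ)) * (N / Λ))
      (cornerLoad Λ lam t + (cornerLoad Λ lam (t + 1) - cornerLoad Λ lam t) * (p / q)) := by
  obtain ⟨r, rfl⟩ := Nat.exists_eq_add_of_le hp
  have hΛ : 0 < Λ := by omega
  have h0 := Nat.choose_pos (n := Λ) (k := t) ht.le
  have h1 := Nat.choose_pos (n := Λ) (k := t + 1) ht
  -- One block has `Nat.choose Λ t` or `Nat.choose Λ (t + 1)` bits; the crossed multiplicities give
  -- the two schemes shares of each file in ratio `r : p`.
  obtain ⟨P, hP, hm, hL⟩ := exists_combined_procedure hΛ lam N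
    (κ := Fin (r * Nat.choose Λ (t + 1)) ⊕ Fin (p * Nat.choose Λ t))
    (Sum.elim (fun _ => t) (fun _ => t + 1))
  have hB : ∑ k : Fin (r * Nat.choose Λ (t + 1)) ⊕ Fin (p * Nat.choose Λ t),
      Nat.choose Λ (Sum.elim (fun _ => t) (fun _ => t + 1) k) =
      (p + r) * (Nat.choose Λ t * Nat.choose Λ (t + 1)) := by
    simp only [Fintype.sum_sum_type, Sum.elim_inl, Sum.elim_inr, Finset.sum_const,
      Finset.card_univ, Fintype.card_fin, smul_eq_mul]
    ring
  have hB' := congrArg (Nat.cast (R := ℝ)) hB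
  have hΛ' : (0 : ℝ) < Λ := by exact_mod_cast hΛ
  have hq' : (0 : ℝ) < p + r := by exact_mod_cast hq
  have h0' : (0 : ℝ) < Nat.choose Λ t := by exact_mod_cast h0
  have h1' : (0 : ℝ) < Nat.choose Λ (t + 1) := by exact_mod_cast h1
  refine ⟨_, ?_, P, hP, ?_, fun d => ?_⟩
  · rw [hB]
    have := Nat.mul_pos hq (Nat.mul_pos h0 h1)
    omega
  · simp only [Fintype.sum_sum_type, Sum.elim_inl, Sum.elim_inr, Finset.sum_const,
      Finset.card_univ, Fintype.card_fin, smul_eq_mul] at hm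
    rw [hB']
    have hm' : (P.cacheBits : ℝ) = N * (r * Nat.choose Λ (t + 1) * (t * Nat.choose Λ t) +
        p * Nat.choose Λ t * ((t + 1) * Nat.choose Λ (t + 1))) / Λ := by
      rw [eq_div_iff hΛ'.ne', mul_comm]
      exact_mod_cast hm
    rw [hm']
    apply le_of_eq
    push_cast
    field_simp
    ring
  · rw [hL, hB']
    simp only [Fintype.sum_sum_type, Sum.elim_inl, Sum.elim_inr, Finset.sum_const,
      Finset.card_univ, Fintype.card_fin, smul_eq_mul, cornerLoad]
    apply le_of_eq
    push_cast
    field_simp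
    ring

/-! ### Passage to arbitrary real memory and the exact infimum -/

theorem AchievableUncoded.mono_memory {Λ lam N : ℕ} {M M' R : ℝ}
    (h : AchievableUncoded Λ lam N M R) (hM : M ≤ M') : AchievableUncoded Λ lam N M' R := by
  obtain ⟨B, hB, P, hP, hc, hL⟩ := h
  exact ⟨B, hB, P, hP, hc.trans (by gcongr), hL⟩

theorem exists_rat_near_below {θ ε : ℝ} (h0 : 0 ≤ θ) (h1 : θ ≤ 1) (hε : 0 < ε) :
    ∃ p q : ℕ, 0 < q ∧ p ≤ q ∧ (p / q : ℝ) ≤ θ ∧ θ ≤ (p / q : ℝ) + ε := by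
  obtain ⟨q, hq⟩ := exists_nat_gt (1 / ε)
  have hq0 : (0 : ℝ) < q := (by positivity : (0 : ℝ) < 1 / ε).trans hq
  have hle : (⌊θ * q⌋₊ : ℝ) ≤ θ * q := Nat.floor_le (by positivity)
  refine ⟨⌊θ * q⌋₊, q, by exact_mod_cast hq0, ?_, ?_, ?_⟩
  · have : (⌊θ * q⌋₊ : ℝ) ≤ q := hle.trans (mul_le_of_le_one_left hq0.le h1)
    exact_mod_cast this
  · rwa [div_le_iff₀ hq0]
  · have := Nat.lt_floor_add_one (θ * q)
    rw [div_lt_iff₀ hε] at hq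
    rw [div_add' _ _ _ hq0.ne', le_div_iff₀ hq0]
    linarith

theorem isGLB_achievable {Λ lam N t : ℕ} (hlam : 1 ≤ lam) (hN : Nat.choose Λ lam ≤ N)
    (hN0 : 0 < N) (ht : t < Λ) {θ : ℝ} (h0 : 0 ≤ θ) (h1 : θ ≤ 1) :
    IsGLB {R : ℝ | AchievableUncoded Λ lam N ((t + θ) * (N / Λ)) R}
      (cornerLoad Λ lam t + (cornerLoad Λ lam (t + 1) - cornerLoad Λ lam t) * θ) := by
  refine ⟨fun R hR => load_ge_of_achievable hlam hN hN0 ht hR, fun b hb => ?_⟩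
  refine le_of_forall_pos_le_add fun ε hε => ?_
  have hD := cornerLoad_succ_le lam ht
  set D := cornerLoad Λ lam t - cornerLoad Λ lam (t + 1) with hDdef
  have hD1 : (0 : ℝ) < D + 1 := by linarith
  -- Approximating from below keeps the memory within budget. The load then exceeds the target by `D
  -- * (θ - p / q)`; dividing by `D + 1` covers `D = 0`.
  obtain ⟨p, q, hq, hpq, hl, hu⟩ := exists_rat_near_below h0 h1 (div_pos hε hD1)
  have hach := (achievable_of_rat (lam := lam) (N := N) ht hq hpq).mono_memory
    (M' := (t + θ) * (N / Λ)) (by gcongr)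
  refine (hb hach).trans ?_
  have h2 : D * (θ - p / q) ≤ ε := by
    calc D * (θ - p / q) ≤ (D + 1) * (ε / (D + 1)) :=
          mul_le_mul (by linarith) (by linarith) (by linarith) hD1.le
      _ = ε := by field_simp
  have h3 : cornerLoad Λ lam (t + 1) - cornerLoad Λ lam t = -D := by rw [hDdef]; ring
  rw [h3]
  linarith

theorem optimalUncodedLoad_eq {Λ lam N t : ℕ} (hlam : 1 ≤ lam) (hN : Nat.choose Λ lam ≤ N)
    (hN0 : 0 < N) (ht : t < Λ) {θ : ℝ} (h0 : 0 ≤ θ) (h1 : θ ≤ 1) :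
    optimalUncodedLoad Λ lam N ((t + θ) * (N / Λ)) =
      cornerLoad Λ lam t + (cornerLoad Λ lam (t + 1) - cornerLoad Λ lam t) * θ := by
  have h := isGLB_achievable hlam hN hN0 ht h0 h1
  exact h.csInf_eq h.nonempty

end MACC

theorem theorem1 (Λ lam N : ℕ) (hlam : 1 ≤ lam) (hlamΛ : lam ≤ Λ) (hN : Nat.choose Λ lam ≤ N) :
    -- on the range of memories `[0, N]` the optimal load is a genuine infimum
    (∀ M : ℝ, 0 ≤ M → M ≤ N →
      IsGLB {R : ℝ | MACC.AchievableUncoded Λ lam N M R} (MACC.optimalUncodedLoad Λ lam N M)) ∧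
    -- the corner points
    (∀ t : ℕ, t ≤ Λ →
      MACC.optimalUncodedLoad Λ lam N ((t : ℝ) * ((N : ℝ) / (Λ : ℝ))) =
        (Nat.choose Λ (t + lam) : ℝ) / (Nat.choose Λ t : ℝ)) ∧
    -- linearity between consecutive corner points
    (∀ t : ℕ, t < Λ → ∀ θ : ℝ, 0 ≤ θ → θ ≤ 1 →
      MACC.optimalUncodedLoad Λ lam N
          ((1 - θ) * ((t : ℝ) * ((N : ℝ) / (Λ : ℝ))) +
            θ * (((t + 1 : ℕ) : ℝ) * ((N : ℝ) / (Λ : ℝ)))) =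
        (1 - θ) * ((Nat.choose Λ (t + lam) : ℝ) / (Nat.choose Λ t : ℝ)) +
          θ * ((Nat.choose Λ (t + 1 + lam) : ℝ) / (Nat.choose Λ (t + 1) : ℝ))) := by
  have hN0 : 0 < N := (Nat.choose_pos hlamΛ).trans_le hN
  have hΛ : (0 : ℝ) < Λ := by exact_mod_cast (hlam.trans hlamΛ : 0 < Λ)
  have hN0' : (0 : ℝ) < N := by exact_mod_cast hN0
  refine ⟨fun M hM0 hMN => ?_, fun t ht => ?_, fun t ht θ h0 h1 => ?_⟩
  · obtain ⟨t, θ, ht, h0, h1, rfl⟩ : ∃ (t : ℕ) (θ : ℝ), t < Λ ∧ 0 ≤ θ ∧ θ ≤ 1 ∧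
        (t + θ) * (N / Λ) = M := by
      set x : ℝ := M * Λ / N with hx
      have hx0 : 0 ≤ x := by positivity
      have hxM : x * (N / Λ) = M := by rw [hx]; field_simp
      have hxΛ : x ≤ Λ := by
        rw [hx, div_le_iff₀ hN0', mul_comm]
        gcongr
      rcases hxΛ.lt_or_eq with h | h
      · refine ⟨⌊x⌋₊, x - ⌊x⌋₊, (Nat.floor_lt hx0).mpr h, ?_, ?_, ?_⟩
        · linarith [Nat.floor_le hx0]
        · linarith [Nat.lt_floor_add_one x]
        · rw [add_sub_cancel, hxM]
      -- The endpoint `M = N` starts no segment, so it is taken as the end of the last one.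
      · refine ⟨Λ - 1, 1, by omega, zero_le_one, le_rfl, ?_⟩
        rw [Nat.cast_sub (hlam.trans hlamΛ), Nat.cast_one, sub_add_cancel, ← hxM, h]
    rw [MACC.optimalUncodedLoad_eq hlam hN hN0 ht h0 h1]
    exact MACC.isGLB_achievable hlam hN hN0 ht h0 h1
  · rcases ht.lt_or_eq with h | rfl
    · have := MACC.optimalUncodedLoad_eq hlam hN hN0 h le_rfl zero_le_one
      simpa [MACC.cornerLoad] using this
    · obtain ⟨s, rfl⟩ : ∃ s, t = s + 1 := Nat.exists_eq_add_one.mpr (hlam.trans hlamΛ)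
      have := MACC.optimalUncodedLoad_eq hlam hN hN0 (Nat.lt_succ_self s) zero_le_one le_rfl
      rw [mul_one, add_sub_cancel] at this
      rw [Nat.cast_add_one]
      exact_mod_cast this
  · have := MACC.optimalUncodedLoad_eq hlam hN hN0 ht h0 h1
    rw [show (1 - θ) * ((t : ℝ) * ((N : ℝ) / (Λ : ℝ))) +
      θ * (((t + 1 : ℕ) : ℝ) * ((N : ℝ) / (Λ : ℝ))) = (t + θ) * (N / Λ) by push_cast; ring, this]
    unfold MACC.cornerLoad
    ring
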